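/- Let $\tau>0$ be such that $\sqrt{\tau/(1+\tau)}\notin\mathbb{Q}$ and let $T>2$. Consider the conservative system $$ \ddot\phi_1-\partial_x^2\phi_1+\partial_x\phi_2=0,\qquad \dot\phi_2-\partial_x\phi_3+\partial_x\dot\phi_1=0,\qquad \tau\dot\phi_3-\partial_x\phi_2=0\qquad\text{in }(0,1)\times(0,\infty), $$ with boundary conditions $\phi_i(0,t)=\phi_i(1,t)=0$ for $i=1,3$, $t>0$, and initial data $\phi_1(\cdot,0)=u_1^0$, $\dot\phi_1(\cdot,0)=u_1^1$, $\phi_2(\cdot,0)=u_2^0$, $\phi_3(\cdot,0)=u_3^0$ on $(0,1)$, all functions being complex valued. Set $$ \dot{\mathcal H}=\Big\{(u_1,u_2,u_3,u_4)\in H^1_0(0,1)\times L^2(0,1)\times L^2(0,1)\times L^2(0,1):\ \int_0^1u_3(x)\,dx=0\Big\}. $$ Then there is a constant $C>0$ (depending only on $\tau$ and $T$) such that for all $(u_1^0,u_1^1,u_2^0,u_3^0)\in\dot{\mathcal H}$ the solution $(\phi_1,\phi_2,\phi_3)$ of this system satisfies $$ \int_0^T\!\!\int_0^1|\phi_3(x,t)|^2\,dx\,dt\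 \ge\ C\,\big\|(u_1^0,u_1^1,u_2^0,u_3^0)\big\|^2_{H^1_0(0,1)\times L^2(0,1)\times L^2(0,1)\times L^2(0,1)} . $$ Here "solution" means the mild solution: $W=(\phi_1,\dot\phi_1,\phi_2,\phi_3)\in C([0,\infty);H^1_0\times L^2\times L^2\times L^2)$ such that $\int_0^tW\,ds\in D(\mathcal A)$ and $W(t)=W(0)+\mathcal A\int_0^tW\,ds$ for all $t\ge0$, where $\mathcal A(u_1,u_2,u_3,u_4)=\big(u_2,\ u_1''-u_3',\ u_4'-u_2',\ \tfrac1\tau u_3'\big)$ and $D(\mathcal A)=(H^2\cap H^1_0)\times H^1_0\times H^1\times H^1_0$. -/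

import Mathlib

open MeasureTheory Set
open scoped ContDiff

namespace Cattaneo

/-- The Lebesgue space `L²(0,1)` of complex valued functions. -/
abbrev L2 : Type := Lp ℂ 2 (volume.restrict (Ioo (0 : ℝ) 1))

/-- Test functions on the interval: smooth functions with compact support in `(0,1)`. -/
def IsTest (η : ℝ → ℂ) : Prop :=
  ContDiff ℝ ∞ η ∧ HasCompactSupport η ∧ tsupport η ⊆ Ioo (0 : ℝ) 1

/-- `g ∈ L²(0,1)` is the weak derivative of `u ∈ L²(0,1)`; in particular `u ∈ H¹(0,1)`. -/
def HasWeakDeriv (u g : L2) : Prop :=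
  ∀ η : ℝ → ℂ, IsTest η →
    ∫ x in Ioo (0 : ℝ) 1, u x * deriv η x = -∫ x in Ioo (0 : ℝ) 1, g x * η x

/-- The pairs `(η, η')`, for `η` a test function on `(0,1)`, in `L² × L²` with the norm
`(‖u‖² + ‖g‖²)^(1/2)`, which on such pairs is the norm of `H¹(0,1)`. -/
def testPairs : Submodule ℂ (WithLp 2 (L2 × L2)) where
  carrier := {p | ∃ η : ℝ → ℂ, IsTest η ∧
    (p.fst =ᵐ[volume.restrict (Ioo (0 : ℝ) 1)] η) ∧
    (p.snd =ᵐ[volume.restrict (Ioo (0 : ℝ) 1)] deriv η)}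
  add_mem' := by
    rintro p q ⟨η, ⟨h1, h2, h3⟩, h4, h5⟩ ⟨θ, ⟨k1, k2, k3⟩, k4, k5⟩
    refine ⟨η + θ, ⟨h1.add k1, h2.add k2,
      (tsupport_add η θ).trans (union_subset h3 k3)⟩, ?_, ?_⟩
    · exact (Lp.coeFn_add p.fst q.fst).trans (h4.add k4)
    · refine (Lp.coeFn_add p.snd q.snd).trans ((h5.add k5).trans (Filter.Eventually.of_forall ?_))
      intro x
      exact (deriv_add (h1.differentiable (by simp) x) (k1.differentiable (by simp) x)).symm
  zero_mem' := by
    refine ⟨0, ⟨contDiff_const, HasCompactSupport.zero, by simp⟩, ?_, ?_⟩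
    · exact Lp.coeFn_zero ℂ 2 _
    · refine (Lp.coeFn_zero ℂ 2 _).trans (Filter.Eventually.of_forall ?_)
      intro x
      simp
  smul_mem' := by
    rintro c p ⟨η, ⟨h1, h2, h3⟩, h4, h5⟩
    refine ⟨c • η, ⟨contDiff_const.smul h1, h2.smul_left (f := fun _ => c),
      (tsupport_smul_subset_right (fun _ => c) η).trans h3⟩, ?_, ?_⟩
    · exact (Lp.coeFn_smul c p.fst).trans (h4.const_smul c)
    · refine (Lp.coeFn_smul c p.snd).trans ((h5.const_smul c).trans
        (Filter.Eventually.of_forall ?_))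
      intro x
      exact (deriv_const_smul c (h1.differentiable (by simp) x)).symm

/-- The Sobolev space `H¹₀(0,1)`: the closure of the test functions in the `H¹` norm. An element
is stored as the pair `(u, u')`, and `‖(u, u')‖² = ‖u‖² + ‖u'‖²`. -/
abbrev H10 : Type := testPairs.topologicalClosure

/-- The underlying `L²` function of an element of `H¹₀(0,1)`. -/
def H10.fn (u : H10) : L2 := (u : WithLp 2 (L2 × L2)).fst

/-- The weak derivative of an element of `H¹₀(0,1)`. -/
def H10.dx (u : H10) : L2 := (u : WithLp 2 (L2 × L2)).snd

/-- The state space `H¹₀ × L² × L² × L²`, whose elements stand for `(φ₁, ∂ₜφ₁, φ₂, φ₃)`. -/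
abbrev State : Type := H10 × L2 × L2 × L2

/-- The square of the Hilbert norm of `H¹₀ × L² × L² × L²`. -/
noncomputable def State.normSq (U : State) : ℝ :=
  ‖U.1‖ ^ 2 + ‖U.2.1‖ ^ 2 + ‖U.2.2.1‖ ^ 2 + ‖U.2.2.2‖ ^ 2

/-- The graph of the generator of the conservative system:
`(u₁, u₂, u₃, u₄) ∈ (H² ∩ H¹₀) × H¹₀ × H¹ × H¹₀` and
`Z = (u₂, u₁'' - u₃', u₄' - u₂', u₃' / τ)`. -/
def IsGenerator (τ : ℝ) (U Z : State) : Prop :=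
  ∃ (d₁ : L2) (w : H10) (d₃ : L2) (q : H10),
    HasWeakDeriv U.1.dx d₁ ∧ w.fn = U.2.1 ∧ HasWeakDeriv U.2.2.1 d₃ ∧ q.fn = U.2.2.2 ∧
    Z.1 = w ∧ Z.2.1 = d₁ - d₃ ∧ Z.2.2.1 = q.dx - w.dx ∧ Z.2.2.2 = ((τ⁻¹ : ℝ) : ℂ) • d₃

/-- `W = (φ₁, ∂ₜφ₁, φ₂, φ₃)` is the (mild, i.e. semigroup) solution with initial data `U`: it is
continuous on `[0,∞)` with values in the state space and, for every `t ≥ 0`, the integral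
`∫₀ᵗ W` lies in the domain of the generator, which maps it to `W t - U`. -/
def IsSolution (τ : ℝ) (U : State) (W : ℝ → State) : Prop :=
  ContinuousOn W (Ici 0) ∧
    ∀ t : ℝ, 0 ≤ t → IsGenerator τ (∫ s in (0 : ℝ)..t, W s) (W t - U)

end Cattaneo

/-!
Sine and cosine series decouple the system: the coefficients at frequency `κ = nπ` solve a `4 × 4`
linear system which, once time is rescaled by `κ`, is generated by the same skew matrix for every
`n`. That matrix is observable through the coefficient of `φ₃` alone, so in any fixed time this
coefficient controls the whole mode. In the rescaled time the observation interval of a mode has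
length proportional to `|n|`, and since the flow preserves the norm it contains about `|n|` windows
with the same lower bound, which makes the constant uniform in `n`. As `φ₃` is observed on the
whole of `(0,1)`, Parseval's identity for the sine series then adds up the modes without
interaction. The mode `n = 0` is not observed; it is excluded by the zero mean of `φ₂`.
-/

namespace Cattaneo

section LinearFlow

open NormedSpace

variable {E F : Type*} [NormedAddCommGroup F] [NormedSpace ℝ F]

section NormedSpace

variable [NormedAddCommGroup E] [NormedSpace ℝ E]

/-- `(A, C)` is observable: only the zero state is invisible through all the outputs `C Aᵏ`
(the Kalman rank condition). -/
def IsObservable (A : E →L[ℝ] E) (C : E →L[ℝ] F) : Prop :=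
  ∀ y, (∀ k : ℕ, C ((A ^ k) y) = 0) → y = 0

section Complete

variable [CompleteSpace E]

theorem exp_add_smul_apply (A : E →L[ℝ] E) (s t : ℝ) (y : E) :
    exp ((s + t) • A) y = exp (s • A) (exp (t • A) y) := by
  let _ : NormedAlgebra ℚ (E →L[ℝ] E) := NormedAlgebra.restrictScalars ℚ ℝ _
  rw [add_smul, exp_add_of_commute (((Commute.refl A).smul_left s).smul_right t)]
  rfl

theorem hasDerivAt_exp_smul_apply (A : E →L[ℝ] E) (y : E) (t : ℝ) :
    HasDerivAt (fun s : ℝ => exp (s • A) y) (A (exp (t • A) y)) t := by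
  simpa using (hasDerivAt_exp_smul_const' A t).clm_apply (hasDerivAt_const t y)

theorem continuous_exp_smul_apply (A : E →L[ℝ] E) :
    Continuous fun p : E × ℝ => exp (p.2 • A) p.1 := by
  have hexp : Continuous fun s : ℝ => exp (s • A) :=
    (differentiable_exp_smul_const ℝ A).continuous
  exact (hexp.comp continuous_snd).clm_apply continuous_fst

theorem continuous_sq_norm_apply_exp_smul (A : E →L[ℝ] E) (C : E →L[ℝ] F) (y : E) :
    Continuous fun t : ℝ => ‖C (exp (t • A) y)‖ ^ 2 :=
  (C.continuous.comp ((continuous_exp_smul_apply A).comp (Continuous.prodMk_right y))).norm.pow 2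

theorem eq_exp_smul_apply_of_eq_add_integral {A : E →L[ℝ] E} {y : ℝ → E} {y₀ : E}
    (hy : ContinuousOn y (Ici 0))
    (h : ∀ t, 0 ≤ t → y t = y₀ + A (∫ s in (0 : ℝ)..t, y s)) {t : ℝ} (ht : 0 ≤ t) :
    y t = exp (t • A) y₀ := by
  have hderiv : ∀ s ∈ Ico 0 t, HasDerivWithinAt y (A (y s)) (Ici s) s := by
    intro s hs
    have hys : ContinuousOn y (Ici s) := hy.mono (Ici_subset_Ici.2 hs.1)
    have hint : IntervalIntegrable y volume 0 s :=
      (hy.mono Icc_subset_Ici_self).intervalIntegrable_of_Icc hs.1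
    have hprim : HasDerivWithinAt (fun r => ∫ x in (0 : ℝ)..r, y x) (y s) (Ici s) s :=
      intervalIntegral.integral_hasDerivWithinAt_right hint
        (ContinuousOn.stronglyMeasurableAtFilter_nhdsWithin
          (hys.mono Ioi_subset_Ici_self) measurableSet_Ioi s)
        ((hys s self_mem_Ici).mono Ioi_subset_Ici_self)
    exact ((A.hasFDerivAt.comp_hasDerivWithinAt s hprim).const_add y₀).congr
      (fun r hr => h r (hs.1.trans hr)) (h s hs.1)
  have hy0 : y 0 = y₀ := by simpa using h 0 le_rfl
  refine ODE_solution_unique (v := fun _ => A) (fun _ => A.lipschitz)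
    (hy.mono Icc_subset_Ici_self) hderiv
    (fun s _ => (hasDerivAt_exp_smul_apply A y₀ s).continuousAt.continuousWithinAt)
    (fun s _ => (hasDerivAt_exp_smul_apply A y₀ s).hasDerivWithinAt) ?_ ⟨ht, le_rfl⟩
  simp [hy0]

theorem apply_pow_exp_smul_eq_zero {A : E →L[ℝ] E} {C : E →L[ℝ] F} {y : E} {s : Set ℝ}
    (hs : IsOpen s) (h : ∀ t ∈ s, C (exp (t • A) y) = 0) (k : ℕ) :
    ∀ t ∈ s, C ((A ^ k) (exp (t • A) y)) = 0 := by
  induction k with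
  | zero => simpa using h
  | succ k ih =>
    intro t ht
    have hderiv : HasDerivAt (fun r : ℝ => C ((A ^ k) (exp (r • A) y)))
        (C ((A ^ k) (A (exp (t • A) y)))) t :=
      (C ∘L A ^ k).hasFDerivAt.comp_hasDerivAt t (hasDerivAt_exp_smul_apply A y t)
    have hzero : HasDerivAt (fun r : ℝ => C ((A ^ k) (exp (r • A) y))) 0 t :=
      (hasDerivAt_const t 0).congr_of_eventuallyEq (Filter.eventually_of_mem (hs.mem_nhds ht) ih)
    simpa [pow_succ] using hderiv.unique hzero

theorem IsObservable.eq_zero_of_forall_mem_Ioo {A : E →L[ℝ] E} {C : E →L[ℝ] F}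
    (h : IsObservable A C) {a b : ℝ} (hab : a < b) {y : E}
    (hy : ∀ t ∈ Ioo a b, C (exp (t • A) y) = 0) : y = 0 := by
  obtain ⟨t, ht⟩ := nonempty_Ioo.2 hab
  have hflow : exp (t • A) y = 0 :=
    h _ fun k => apply_pow_exp_smul_eq_zero isOpen_Ioo hy k t ht
  simpa [hflow] using exp_add_smul_apply A (-t) t y

end Complete

theorem IsObservable.exists_mul_sq_norm_le_integral [FiniteDimensional ℝ E] {A : E →L[ℝ] E}
    {C : E →L[ℝ] F} (h : IsObservable A C) {L : ℝ} (hL : 0 < L) :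
    ∃ c : ℝ, 0 < c ∧ ∀ y, c * ‖y‖ ^ 2 ≤ ∫ t in (0 : ℝ)..L, ‖C (exp (t • A) y)‖ ^ 2 := by
  have := FiniteDimensional.complete ℝ E
  rcases subsingleton_or_nontrivial E with _ | _
  · exact ⟨1, one_pos, fun y => by simp [Subsingleton.elim y 0]⟩
  set obs : E → ℝ := fun y => ∫ t in (0 : ℝ)..L, ‖C (exp (t • A) y)‖ ^ 2 with hobs
  have hcont : Continuous fun p : E × ℝ => ‖C (exp (p.2 • A) p.1)‖ ^ 2 :=
    (C.continuous.comp (continuous_exp_smul_apply A)).norm.pow 2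
  have hsmul : ∀ (r : ℝ) (y : E), obs (r • y) = r ^ 2 * obs y := fun r y => by
    simp [hobs, norm_smul, mul_pow]
  have hpos : ∀ y, y ≠ 0 → 0 < obs y := by
    intro y hy
    obtain ⟨t, ht, hne⟩ : ∃ t ∈ Ioo 0 L, C (exp (t • A) y) ≠ 0 := by
      by_contra! hzero
      exact hy (h.eq_zero_of_forall_mem_Ioo hL hzero)
    exact intervalIntegral.integral_pos hL
      (continuous_sq_norm_apply_exp_smul A C y).continuousOn (fun _ _ => by positivity)
      ⟨t, Ioo_subset_Icc_self ht, by positivity⟩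
  obtain ⟨y₀, hy₀, hmin⟩ := (isCompact_sphere (0 : E) 1).exists_isMinOn
    (NormedSpace.sphere_nonempty.2 zero_le_one)
    (intervalIntegral.continuous_parametric_intervalIntegral_of_continuous (μ := volume)
      (f := fun y t => ‖C (exp (t • A) y)‖ ^ 2) (a₀ := 0) (s := fun _ => L) hcont
      continuous_const).continuousOn
  refine ⟨obs y₀, hpos y₀ (ne_zero_of_mem_unit_sphere ⟨y₀, hy₀⟩), fun y => ?_⟩
  rcases eq_or_ne y 0 with rfl | hy
  · simp
  calc obs y₀ * ‖y‖ ^ 2 ≤ obs (‖y‖⁻¹ • y) * ‖y‖ ^ 2 := by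
        gcongr
        exact hmin (by simp [norm_smul, hy])
    _ = obs y := by
        rw [hsmul]
        field_simp

end NormedSpace

variable [NormedAddCommGroup E] [InnerProductSpace ℝ E]

section Skew

variable [CompleteSpace E]

theorem norm_exp_smul_apply_of_skew {A : E →L[ℝ] E} (hA : ∀ x, inner ℝ x (A x) = 0) (t : ℝ)
    (y : E) : ‖exp (t • A) y‖ = ‖y‖ := by
  have hderiv : ∀ s, HasDerivAt (fun s : ℝ => ‖exp (s • A) y‖ ^ 2) 0 s := fun s => by
    simpa [hA] using (hasDerivAt_exp_smul_apply A y s).norm_sq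
  have hconst := is_const_of_deriv_eq_zero (fun s => (hderiv s).differentiableAt)
    (fun s => (hderiv s).deriv) t 0
  simpa using hconst

theorem nat_mul_le_integral_of_skew {A : E →L[ℝ] E} (hA : ∀ x, inner ℝ x (A x) = 0)
    {C : E →L[ℝ] F} {c L : ℝ}
    (hobs : ∀ y, c * ‖y‖ ^ 2 ≤ ∫ t in (0 : ℝ)..L, ‖C (exp (t • A) y)‖ ^ 2) (n : ℕ) (y : E) :
    n * (c * ‖y‖ ^ 2) ≤ ∫ t in (0 : ℝ)..n * L, ‖C (exp (t • A) y)‖ ^ 2 := by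
  have hcont := continuous_sq_norm_apply_exp_smul A C y
  induction n with
  | zero => simp
  | succ n ih =>
    have hlast : c * ‖y‖ ^ 2 ≤ ∫ t in n * L..(n + 1 : ℕ) * L, ‖C (exp (t • A) y)‖ ^ 2 := by
      have hshift := hobs (exp ((n * L) • A) y)
      simp_rw [norm_exp_smul_apply_of_skew hA, ← exp_add_smul_apply] at hshift
      rw [intervalIntegral.integral_comp_add_right
        (fun t : ℝ => ‖C (exp (t • A) y)‖ ^ 2)] at hshift
      convert hshift using 2 <;> push_cast <;> ring
    rw [← intervalIntegral.integral_add_adjacent_intervals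
      (hcont.intervalIntegrable 0 (n * L)) (hcont.intervalIntegrable _ _)]
    push_cast at hlast ⊢
    linarith

theorem half_mul_le_integral_mul_of_skew {A : E →L[ℝ] E} (hA : ∀ x, inner ℝ x (A x) = 0)
    {C : E →L[ℝ] F} {c L : ℝ} (hc : 0 ≤ c) (hL : 0 ≤ L)
    (hobs : ∀ y, c * ‖y‖ ^ 2 ≤ ∫ t in (0 : ℝ)..L, ‖C (exp (t • A) y)‖ ^ 2) {r : ℝ} (hr : 1 ≤ r)
    (y : E) : c / 2 * ‖y‖ ^ 2 ≤ ∫ t in (0 : ℝ)..L, ‖C (exp ((r * t) • A) y)‖ ^ 2 := by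
  have hfloor : r / 2 ≤ (⌊r⌋₊ : ℝ) := by
    have : (1 : ℝ) ≤ ⌊r⌋₊ := by exact_mod_cast (Nat.one_le_floor_iff r).2 hr
    linarith [Nat.lt_floor_add_one r]
  rw [intervalIntegral.integral_comp_mul_left (fun t : ℝ => ‖C (exp (t • A) y)‖ ^ 2)
    (by positivity), mul_zero, smul_eq_mul, inv_mul_eq_div, le_div_iff₀ (by positivity)]
  calc c / 2 * ‖y‖ ^ 2 * r = r / 2 * (c * ‖y‖ ^ 2) := by ring
    _ ≤ ⌊r⌋₊ * (c * ‖y‖ ^ 2) := by gcongr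
    _ ≤ ∫ t in (0 : ℝ)..⌊r⌋₊ * L, ‖C (exp (t • A) y)‖ ^ 2 :=
      nat_mul_le_integral_of_skew hA hobs _ y
    _ ≤ ∫ t in (0 : ℝ)..r * L, ‖C (exp (t • A) y)‖ ^ 2 :=
      intervalIntegral.integral_mono_interval le_rfl (by positivity)
        (by gcongr; exact Nat.floor_le (by positivity))
        (Filter.Eventually.of_forall fun _ => by positivity)
        ((continuous_sq_norm_apply_exp_smul A C y).intervalIntegrable _ _)

end Skew

theorem IsObservable.exists_mul_sq_norm_le_integral_of_skew [FiniteDimensional ℝ E]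
    {A : E →L[ℝ] E} {C : E →L[ℝ] F} (h : IsObservable A C) (hA : ∀ x, inner ℝ x (A x) = 0)
    {L : ℝ} (hL : 0 < L) :
    ∃ c : ℝ, 0 < c ∧ ∀ r : ℝ, 1 ≤ |r| → ∀ y,
      c * ‖y‖ ^ 2 ≤ ∫ t in (0 : ℝ)..L, ‖C (exp ((r * t) • A) y)‖ ^ 2 := by
  have := FiniteDimensional.complete ℝ E
  obtain ⟨c, hc, hobs⟩ := h.exists_mul_sq_norm_le_integral hL
  refine ⟨c / 2, by positivity, fun r hr y => ?_⟩
  rcases le_abs.1 hr with hr | hr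
  · exact half_mul_le_integral_mul_of_skew hA hc.le hL.le hobs hr y
  · -- For negative `r`, run the flow backwards from its state at time `L`.
    have hback := half_mul_le_integral_mul_of_skew hA hc.le hL.le hobs hr (exp ((r * L) • A) y)
    simp_rw [norm_exp_smul_apply_of_skew hA, ← exp_add_smul_apply] at hback
    have hreflect := intervalIntegral.integral_comp_sub_left (a := 0) (b := L)
      (fun t : ℝ => ‖C (exp ((r * t) • A) y)‖ ^ 2) L
    rw [sub_self, sub_zero] at hreflect
    rw [← hreflect]
    convert hback using 7
    ring_nf

end LinearFlow

section Pairing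

theorem memLp_continuousMap (φ : C(ℝ, ℂ)) : MemLp φ 2 (volume.restrict (Ioo (0 : ℝ) 1)) := by
  obtain ⟨B, hB⟩ :=
    (isCompact_Icc (a := (0 : ℝ)) (b := 1)).exists_bound_of_continuousOn φ.continuous.continuousOn
  exact MemLp.of_bound φ.continuous.aestronglyMeasurable B
    ((ae_restrict_mem measurableSet_Ioo).mono fun x hx => hB x (Ioo_subset_Icc_self hx))

theorem integrableOn_L2 (f : L2) : IntegrableOn f (Ioo (0 : ℝ) 1) :=
  (Lp.memLp f).integrable one_le_two

theorem integrableOn_mul_continuous {f φ : ℝ → ℂ} (hf : IntegrableOn f (Ioo (0 : ℝ) 1))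
    (hφ : Continuous φ) : IntegrableOn (fun x => f x * φ x) (Ioo (0 : ℝ) 1) :=
  hf.mul_continuousOn_of_subset hφ.continuousOn measurableSet_Ioo isCompact_Icc
    Ioo_subset_Icc_self

theorem integral_norm_sq (f : L2) : ∫ x in Ioo (0 : ℝ) 1, ‖f x‖ ^ 2 = ‖f‖ ^ 2 := by
  rw [← inner_self_eq_norm_sq (𝕜 := ℂ), L2.inner_def, ← integral_re (L2.integrable_inner f f)]
  simp only [inner_self_eq_norm_sq]

/-- The bilinear (not sesquilinear) pairing `f ↦ ∫₀¹ f φ` with a continuous function, as a bounded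
functional on `L²(0,1)`. -/
noncomputable def pairing (φ : C(ℝ, ℂ)) : L2 →L[ℂ] ℂ :=
  innerSL ℂ (memLp_continuousMap (star φ)).toLp

theorem pairing_apply (φ : C(ℝ, ℂ)) (f : L2) :
    pairing φ f = ∫ x in Ioo (0 : ℝ) 1, f x * φ x := by
  rw [pairing, innerSL_apply_apply, L2.inner_def]
  refine integral_congr_ae ?_
  filter_upwards [(memLp_continuousMap (star φ)).coeFn_toLp] with x hx
  rw [hx]
  simp

end Pairing

section WeakDeriv

theorem integral_primitive_mul_deriv {a b : ℝ} {g φ φ' : ℝ → ℂ} (hg : IntegrableOn g (Ioo a b))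
    (hφ : ∀ x, HasDerivAt φ (φ' x) x) (hφ' : Continuous φ') :
    ∫ x in Ioo a b, (∫ y in Ioo a x, g y) * φ' x =
      (∫ x in Ioo a b, g x) * φ b - ∫ x in Ioo a b, g x * φ x := by
  have hφc : Continuous φ := continuous_iff_continuousAt.2 fun x => (hφ x).continuousAt
  have hbdd : ∀ {f : ℝ → ℂ}, Continuous f → IntegrableOn f (Ioo a b) := fun hf =>
    (hf.integrableOn_Icc).mono_set Ioo_subset_Icc_self
  have hprod : Integrable ({p : ℝ × ℝ | p.2 < p.1}.indicator fun p => φ' p.1 * g p.2)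
      ((volume.restrict (Ioo a b)).prod (volume.restrict (Ioo a b))) :=
    ((hbdd hφ').mul_prod hg).indicator (measurableSet_lt measurable_snd measurable_fst)
  have hinner : ∀ x ∈ Ioo a b, (∫ y in Ioo a x, g y) * φ' x =
      ∫ y in Ioo a b, {p : ℝ × ℝ | p.2 < p.1}.indicator (fun p => φ' p.1 * g p.2) (x, y) := by
    intro x hx
    have : Ioo a x = Ioo a b ∩ Iio x := by
      rw [Ioo_inter_Iio, min_eq_right hx.2.le]
    rw [this, ← setIntegral_indicator measurableSet_Iio, mul_comm, ← integral_const_mul]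
    congr with y
    by_cases hy : y < x <;> simp [hy]
  have houter : ∀ y ∈ Ioo a b,
      ∫ x in Ioo a b, {p : ℝ × ℝ | p.2 < p.1}.indicator (fun p => φ' p.1 * g p.2) (x, y) =
        g y * φ b - g y * φ y := by
    intro y hy
    have : Ioo y b = Ioo a b ∩ Ioi y := by
      rw [Ioo_inter_Ioi, max_eq_right hy.1.le]
    rw [← mul_sub, ← intervalIntegral.integral_eq_sub_of_hasDerivAt (fun x _ => hφ x)
      (hφ'.intervalIntegrable y b), intervalIntegral.integral_of_le hy.2.le,
      integral_Ioc_eq_integral_Ioo, this, ← setIntegral_indicator measurableSet_Ioi,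
      ← integral_const_mul]
    congr with x
    by_cases hx : y < x <;> simp [hx, mul_comm]
  have hgφ : IntegrableOn (fun x => g x * φ x) (Ioo a b) :=
    hg.mul_continuousOn_of_subset hφc.continuousOn measurableSet_Ioo isCompact_Icc
      Ioo_subset_Icc_self
  calc ∫ x in Ioo a b, (∫ y in Ioo a x, g y) * φ' x
      = ∫ y in Ioo a b, (g y * φ b - g y * φ y) := by
        rw [setIntegral_congr_fun measurableSet_Ioo hinner,
          integral_integral_swap (f := fun x y =>
            {p : ℝ × ℝ | p.2 < p.1}.indicator (fun p => φ' p.1 * g p.2) (x, y)) hprod,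
          setIntegral_congr_fun measurableSet_Ioo houter]
    _ = _ := by rw [integral_sub (hg.mul_const _) hgφ, integral_mul_const]

theorem IsTest.apply_eq_zero {η : ℝ → ℂ} (hη : IsTest η) {x : ℝ} (hx : x ∉ Ioo (0 : ℝ) 1) :
    η x = 0 :=
  image_eq_zero_of_notMem_tsupport fun hmem => hx (hη.2.2 hmem)

theorem IsTest.hasDerivAt {η : ℝ → ℂ} (hη : IsTest η) (x : ℝ) : HasDerivAt η (deriv η x) x :=
  (hη.1.differentiable (by simp) x).hasDerivAt

theorem IsTest.continuous_deriv {η : ℝ → ℂ} (hη : IsTest η) : Continuous (deriv η) :=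
  hη.1.continuous_deriv (by simp)

theorem IsTest.integrableOn {η : ℝ → ℂ} (hη : IsTest η) : IntegrableOn η (Ioo (0 : ℝ) 1) :=
  (hη.1.continuous.integrable_of_hasCompactSupport hη.2.1).integrableOn

theorem integral_deriv_mul_of_isTest {η φ φ' : ℝ → ℂ} (hη : IsTest η)
    (hφ : ∀ x, HasDerivAt φ (φ' x) x) (hφ' : Continuous φ') :
    ∫ x in Ioo (0 : ℝ) 1, deriv η x * φ x = -∫ x in Ioo (0 : ℝ) 1, η x * φ' x := by
  have hparts := intervalIntegral.integral_mul_deriv_eq_deriv_mul (a := 0) (b := 1)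
    (fun x _ => hφ x) (fun x _ => hη.hasDerivAt x) (hφ'.intervalIntegrable 0 1)
    (hη.continuous_deriv.intervalIntegrable 0 1)
  rw [hη.apply_eq_zero (by simp), hη.apply_eq_zero (by simp)] at hparts
  simpa [intervalIntegral.integral_of_le, integral_Ioc_eq_integral_Ioo, mul_comm] using hparts

theorem IsTest.exists_deriv_eq {θ : ℝ → ℂ} (hθ : IsTest θ)
    (hθ₀ : ∫ x in Ioo (0 : ℝ) 1, θ x = 0) : ∃ η, IsTest η ∧ deriv η = θ := by
  obtain ⟨hsmooth, hcpt, hsupp⟩ := hθ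
  obtain ⟨a, b, ha, hb, hab⟩ : ∃ a b, 0 < a ∧ b < 1 ∧ tsupport θ ⊆ Icc a b := by
    rcases (tsupport θ).eq_empty_or_nonempty with hempty | hne
    · exact ⟨1, 0, one_pos, zero_lt_one, by simp [hempty]⟩
    · exact ⟨sInf (tsupport θ), sSup (tsupport θ), (hsupp (hcpt.isCompact.sInf_mem hne)).1,
        (hsupp (hcpt.isCompact.sSup_mem hne)).2,
        subset_Icc_csInf_csSup hcpt.isCompact.bddBelow hcpt.isCompact.bddAbove⟩
  set η : ℝ → ℂ := fun x => ∫ y in (0 : ℝ)..x, θ y with hη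
  have hderiv : ∀ x, HasDerivAt η (θ x) x := fun x =>
    (hsmooth.continuous.integral_hasStrictDerivAt 0 x).hasDerivAt
  have hη_eq : deriv η = θ := funext fun x => (hderiv x).deriv
  have hvanish : ∀ {c x : ℝ}, (∀ y ∈ uIoc c x, y ∉ Icc a b) → ∫ y in c..x, θ y = 0 := fun h =>
    intervalIntegral.integral_zero_ae (Filter.Eventually.of_forall fun y hy =>
      image_eq_zero_of_notMem_tsupport (mt (@hab y) (h y hy)))
  have hleft : ∀ x < a, η x = 0 := fun x hx => hvanish fun y hy hy' => by
    rcases mem_uIoc.1 hy with hy | hy <;> linarith [hy.1, hy.2, hy'.1]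
  have hright : ∀ x, b < x → η x = 0 := by
    intro x hx
    have hone : ∫ y in (0 : ℝ)..1, θ y = 0 := by
      rw [intervalIntegral.integral_of_le zero_le_one, integral_Ioc_eq_integral_Ioo, hθ₀]
    have htail : ∫ y in (1 : ℝ)..x, θ y = 0 := hvanish fun y hy hy' => by
      rcases mem_uIoc.1 hy with hy | hy <;> linarith [hy.1, hy.2, hy'.2]
    simp only [hη]
    rw [← intervalIntegral.integral_add_adjacent_intervals
      (hsmooth.continuous.intervalIntegrable 0 1) (hsmooth.continuous.intervalIntegrable 1 x),
      hone, htail, add_zero]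
  have hsub : tsupport η ⊆ Icc a b := by
    refine closure_minimal (fun x hx => ?_) isClosed_Icc
    exact ⟨not_lt.1 fun h => hx (hleft x h), not_lt.1 fun h => hx (hright x h)⟩
  refine ⟨η, ⟨?_, isCompact_Icc.of_isClosed_subset (isClosed_tsupport η) hsub,
    hsub.trans fun x hx => ⟨ha.trans_le hx.1, hx.2.trans_lt hb⟩⟩, hη_eq⟩
  rw [contDiff_infty_iff_deriv, hη_eq]
  exact ⟨fun x => (hderiv x).differentiableAt, hsmooth⟩

theorem isTest_ofReal {η : ℝ → ℝ} (hη : ContDiff ℝ ∞ η) (hcpt : HasCompactSupport η)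
    (hsupp : tsupport η ⊆ Ioo (0 : ℝ) 1) : IsTest fun x => (η x : ℂ) :=
  ⟨Complex.ofRealCLM.contDiff.comp hη, hcpt.comp_left Complex.ofReal_zero,
    (closure_mono (Function.support_comp_subset Complex.ofReal_zero η)).trans hsupp⟩

theorem IsTest.sub_smul {η θ : ℝ → ℂ} (hη : IsTest η) (hθ : IsTest θ) (c : ℂ) :
    IsTest (η - c • θ) := by
  obtain ⟨hθ₁, hθ₂, hθ₃⟩ := hθ
  have hcθ : tsupport (c • θ) ⊆ tsupport θ := tsupport_smul_subset_right (fun _ => c) θ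
  exact ⟨hη.1.sub (contDiff_const.smul hθ₁), hη.2.1.sub (hθ₂.smul_left (f := fun _ => c)),
    (tsupport_sub η (c • θ)).trans (union_subset hη.2.2 (hcθ.trans hθ₃))⟩

theorem setIntegral_eq_integral_of_tsupport_subset {f : ℝ → ℂ}
    (hf : tsupport f ⊆ Ioo (0 : ℝ) 1) : ∫ x in Ioo (0 : ℝ) 1, f x = ∫ x, f x :=
  setIntegral_eq_integral_of_forall_compl_eq_zero fun _ hx =>
    image_eq_zero_of_notMem_tsupport (mt (@hf _) hx)

theorem exists_isTest_integral_eq_one :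
    ∃ ρ, IsTest ρ ∧ ∫ x in Ioo (0 : ℝ) 1, ρ x = 1 := by
  let bump : ContDiffBump (1 / 2 : ℝ) := ⟨1 / 8, 1 / 4, by norm_num, by norm_num⟩
  have hρ : IsTest fun x => (bump.normed volume x : ℂ) := by
    refine isTest_ofReal bump.contDiff_normed bump.hasCompactSupport_normed ?_
    rw [bump.tsupport_normed_eq, Real.closedBall_eq_Icc]
    exact Icc_subset_Ioo (by norm_num [bump]) (by norm_num [bump])
  refine ⟨_, hρ, ?_⟩
  rw [setIntegral_eq_integral_of_tsupport_subset hρ.2.2, integral_complex_ofReal,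
    bump.integral_normed, Complex.ofReal_one]

theorem exists_integral_mul_eq_mul_integral {f : ℝ → ℂ} (hf : IntegrableOn f (Ioo (0 : ℝ) 1))
    (h : ∀ η, IsTest η → ∫ x in Ioo (0 : ℝ) 1, f x * deriv η x = 0) :
    ∃ c : ℂ, ∀ η, IsTest η →
      ∫ x in Ioo (0 : ℝ) 1, f x * η x = c * ∫ x in Ioo (0 : ℝ) 1, η x := by
  obtain ⟨ρ, hρ, hρ₁⟩ := exists_isTest_integral_eq_one
  refine ⟨∫ x in Ioo (0 : ℝ) 1, f x * ρ x, fun η hη => ?_⟩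
  set m := ∫ x in Ioo (0 : ℝ) 1, η x
  obtain ⟨ζ, hζ, hζ'⟩ := (hη.sub_smul hρ m).exists_deriv_eq (by
    simp only [Pi.sub_apply, Pi.smul_apply, smul_eq_mul]
    rw [integral_sub hη.integrableOn (hρ.integrableOn.const_mul m), integral_const_mul, hρ₁,
      mul_one, sub_self])
  have hfζ := h ζ hζ
  simp only [hζ', Pi.sub_apply, Pi.smul_apply, smul_eq_mul, mul_sub, mul_left_comm _ m] at hfζ
  rw [integral_sub (integrableOn_mul_continuous hf hη.1.continuous)
    ((integrableOn_mul_continuous hf hρ.1.continuous).const_mul m), integral_const_mul] at hfζ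
  rw [sub_eq_zero.1 hfζ, mul_comm]

theorem exists_ae_eq_const_of_integral_mul_deriv_eq_zero {f : ℝ → ℂ}
    (hf : IntegrableOn f (Ioo (0 : ℝ) 1))
    (h : ∀ η, IsTest η → ∫ x in Ioo (0 : ℝ) 1, f x * deriv η x = 0) :
    ∃ c : ℂ, ∀ᵐ x ∂volume.restrict (Ioo (0 : ℝ) 1), f x = c := by
  obtain ⟨c, hc⟩ := exists_integral_mul_eq_mul_integral hf h
  refine ⟨c, (ae_restrict_iff' measurableSet_Ioo).2 ?_⟩
  have hconst : IntegrableOn (fun _ => c) (Ioo (0 : ℝ) 1) := integrableOn_const (by simp)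
  have hzero := isOpen_Ioo.ae_eq_zero_of_integral_contDiff_smul_eq_zero
    (hf.sub hconst).locallyIntegrableOn fun η hη hcpt hsupp => by
    have hηtest := isTest_ofReal hη hcpt hsupp
    rw [← setIntegral_eq_integral_of_tsupport_subset
      ((tsupport_smul_subset_left η _).trans hsupp)]
    simp only [Complex.real_smul, Pi.sub_apply, mul_comm (η _ : ℂ), sub_mul]
    rw [integral_sub (integrableOn_mul_continuous hf hηtest.1.continuous)
      (hηtest.integrableOn.const_mul c), hc _ hηtest, integral_const_mul, sub_self]
  filter_upwards [hzero] with x hx hmem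
  exact sub_eq_zero.1 (hx hmem)

theorem integrableOn_integral_Ioo {g : ℝ → ℂ} (hg : IntegrableOn g (Ioo (0 : ℝ) 1)) :
    IntegrableOn (fun x => ∫ y in Ioo 0 x, g y) (Ioo (0 : ℝ) 1) := by
  have hcont : ContinuousOn (fun x => ∫ y in Ioo 0 x, g y) (Icc 0 1) := by
    simpa only [integral_Ioc_eq_integral_Ioo] using
      intervalIntegral.continuousOn_primitive ((integrableOn_Icc_iff_integrableOn_Ioo).2 hg)
  exact hcont.integrableOn_Icc.mono_set Ioo_subset_Icc_self

theorem HasWeakDeriv.exists_ae_eq_const_add_primitive {u g : L2} (h : HasWeakDeriv u g) :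
    ∃ c : ℂ, ∀ᵐ x ∂volume.restrict (Ioo (0 : ℝ) 1), u x = c + ∫ y in Ioo 0 x, g y := by
  have hprim := integrableOn_integral_Ioo (integrableOn_L2 g)
  obtain ⟨c, hc⟩ := exists_ae_eq_const_of_integral_mul_deriv_eq_zero
    ((integrableOn_L2 u).sub hprim) fun η hη => by
    simp only [Pi.sub_apply, sub_mul]
    rw [integral_sub (integrableOn_mul_continuous (integrableOn_L2 u) hη.continuous_deriv)
      (integrableOn_mul_continuous hprim hη.continuous_deriv), h η hη,
      integral_primitive_mul_deriv (integrableOn_L2 g) hη.hasDerivAt hη.continuous_deriv,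
      hη.apply_eq_zero (by simp)]
    ring
  exact ⟨c, hc.mono fun x hx => by rw [← hx, Pi.sub_apply, sub_add_cancel]⟩

theorem HasWeakDeriv.integral_mul_deriv {u g : L2} (h : HasWeakDeriv u g) {φ φ' : ℝ → ℂ}
    (hφ : ∀ x, HasDerivAt φ (φ' x) x) (hφ' : Continuous φ') (h₀ : φ 0 = 0) (h₁ : φ 1 = 0) :
    ∫ x in Ioo (0 : ℝ) 1, u x * φ' x = -∫ x in Ioo (0 : ℝ) 1, g x * φ x := by
  obtain ⟨c, hc⟩ := h.exists_ae_eq_const_add_primitive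
  have hprim := integrableOn_integral_Ioo (integrableOn_L2 g)
  have hφ'int : IntegrableOn φ' (Ioo (0 : ℝ) 1) :=
    hφ'.integrableOn_Icc.mono_set Ioo_subset_Icc_self
  have hφ'₀ : ∫ x in Ioo (0 : ℝ) 1, φ' x = 0 := by
    rw [← integral_Ioc_eq_integral_Ioo, ← intervalIntegral.integral_of_le zero_le_one,
      intervalIntegral.integral_eq_sub_of_hasDerivAt (fun x _ => hφ x)
        (hφ'.intervalIntegrable 0 1), h₀, h₁, sub_self]
  calc ∫ x in Ioo (0 : ℝ) 1, u x * φ' x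
      = ∫ x in Ioo (0 : ℝ) 1, (c * φ' x + (∫ y in Ioo 0 x, g y) * φ' x) :=
        integral_congr_ae (hc.mono fun x hx => by simp only [hx, add_mul])
    _ = ∫ x in Ioo (0 : ℝ) 1, (∫ y in Ioo 0 x, g y) * φ' x := by
        rw [integral_add (hφ'int.const_mul c) (integrableOn_mul_continuous hprim hφ'),
          integral_const_mul, hφ'₀, mul_zero, zero_add]
    _ = -∫ x in Ioo (0 : ℝ) 1, g x * φ x := by
        rw [integral_primitive_mul_deriv (integrableOn_L2 g) hφ hφ', h₁, mul_zero, zero_sub]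

theorem H10.integral_dx_mul (u : H10) {φ φ' : ℝ → ℂ}
    (hφ : ∀ x, HasDerivAt φ (φ' x) x) (hφ' : Continuous φ') :
    ∫ x in Ioo (0 : ℝ) 1, u.dx x * φ x = -∫ x in Ioo (0 : ℝ) 1, u.fn x * φ' x := by
  let φc : C(ℝ, ℂ) := ⟨φ, continuous_iff_continuousAt.2 fun x => (hφ x).continuousAt⟩
  let φ'c : C(ℝ, ℂ) := ⟨φ', hφ'⟩
  have hclosed : IsClosed {p : WithLp 2 (L2 × L2) | pairing φc p.snd = -pairing φ'c p.fst} :=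
    isClosed_eq (by fun_prop) (by fun_prop)
  have htest : (testPairs : Set (WithLp 2 (L2 × L2))) ⊆
      {p | pairing φc p.snd = -pairing φ'c p.fst} := by
    rintro p ⟨η, hη, hfst, hsnd⟩
    rw [mem_ofPred_eq, pairing_apply, pairing_apply,
      integral_congr_ae (hsnd.mono fun x hx => congrArg (· * φc x) hx),
      integral_congr_ae (hfst.mono fun x hx => congrArg (· * φ'c x) hx)]
    exact integral_deriv_mul_of_isTest hη hφ hφ'
  have hu : pairing φc u.dx = -pairing φ'c u.fn := closure_minimal htest hclosed u.2
  rwa [pairing_apply, pairing_apply] at hu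

end WeakDeriv

section Fourier

open scoped Real

/-- The extension to the line, by zero outside `(-1,1)`, of the restriction of `f` to `(0,1)`; it is
even for `σ = 1` and odd for `σ = -1`. -/
noncomputable def parityExt (σ : ℂ) (f : ℝ → ℂ) (x : ℝ) : ℂ :=
  (Ioo 0 1).indicator f x + σ * (Ioo 0 1).indicator f (-x)

theorem memLp_parityExt (σ : ℂ) {f : ℝ → ℂ} (hf : MemLp f 2 (volume.restrict (Ioo (0 : ℝ) 1))) :
    MemLp (parityExt σ f) 2 := by
  have hind : MemLp ((Ioo (0 : ℝ) 1).indicator f) 2 :=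
    (memLp_indicator_iff_restrict measurableSet_Ioo).2 hf
  exact hind.add
    ((hind.comp_measurePreserving (Measure.measurePreserving_neg volume)).const_mul σ)

theorem map_parityExt {E : Type*} [AddCommMonoid E] (σ : ℂ) (f : ℝ → ℂ) (F : ℝ → ℂ → E)
    (hF : ∀ x, F x 0 = 0) (x : ℝ) :
    F x (parityExt σ f x) = (Ioo 0 1).indicator (fun y => F y (f y)) x +
      (Ioo 0 1).indicator (fun y => F (-y) (σ * f y)) (-x) := by
  by_cases hx : x ∈ Ioo (0 : ℝ) 1
  · have hneg : -x ∉ Ioo (0 : ℝ) 1 := fun h => lt_asymm hx.1 (neg_pos.1 h.1)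
    simp only [parityExt, indicator_of_mem hx, indicator_of_notMem hneg, mul_zero, add_zero]
  · by_cases hneg : -x ∈ Ioo (0 : ℝ) 1
    · simp only [parityExt, indicator_of_mem hneg, indicator_of_notMem hx, neg_neg, zero_add]
    · simp only [parityExt, indicator_of_notMem hneg, indicator_of_notMem hx, mul_zero, add_zero,
        hF]

theorem integral_indicator_add_indicator_neg {E : Type*} [NormedAddCommGroup E] [NormedSpace ℝ E]
    {g h : ℝ → E} (hg : IntegrableOn g (Ioo (0 : ℝ) 1)) (hh : IntegrableOn h (Ioo (0 : ℝ) 1)) :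
    ∫ x in (-1 : ℝ)..1, ((Ioo 0 1).indicator g x + (Ioo 0 1).indicator h (-x)) =
      ∫ x in Ioo (0 : ℝ) 1, (g x + h x) := by
  have hind : ∀ {k : ℝ → E}, IntegrableOn k (Ioo (0 : ℝ) 1) →
      Integrable ((Ioo (0 : ℝ) 1).indicator k) :=
    fun hk => hk.integrable_indicator measurableSet_Ioo
  have hunit : ∀ k : ℝ → E,
      ∫ x in (-1 : ℝ)..1, (Ioo (0 : ℝ) 1).indicator k x = ∫ x in Ioo (0 : ℝ) 1, k x := by
    intro k
    rw [intervalIntegral.integral_of_le (by norm_num), setIntegral_indicator measurableSet_Ioo,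
      inter_eq_right.2 (Ioo_subset_Ioc_self.trans (Ioc_subset_Ioc_left (by norm_num)))]
  rw [intervalIntegral.integral_add (hind hg).intervalIntegrable
    (hind hh).comp_neg.intervalIntegrable,
    intervalIntegral.integral_comp_neg (f := (Ioo (0 : ℝ) 1).indicator h), neg_neg, hunit, hunit,
    integral_add hg hh]

theorem integral_norm_sq_parityExt {σ : ℂ} (hσ : ‖σ‖ = 1) {f : ℝ → ℂ}
    (hf : MemLp f 2 (volume.restrict (Ioo (0 : ℝ) 1))) :
    ∫ x in (-1 : ℝ)..1, ‖parityExt σ f x‖ ^ 2 = 2 * ∫ x in Ioo (0 : ℝ) 1, ‖f x‖ ^ 2 := by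
  have hsq : IntegrableOn (fun x => ‖f x‖ ^ 2) (Ioo (0 : ℝ) 1) :=
    hf.integrable_norm_pow two_ne_zero
  simp_rw [map_parityExt σ f (fun _ z => ‖z‖ ^ 2) (by simp), norm_mul, hσ, one_mul]
  rw [integral_indicator_add_indicator_neg hsq hsq, ← integral_const_mul]
  simp only [two_mul]

theorem fourierCoeffOn_parityExt (σ : ℂ) {f : ℝ → ℂ} (hf : IntegrableOn f (Ioo (0 : ℝ) 1))
    (n : ℤ) :
    fourierCoeffOn (by norm_num : (-1 : ℝ) < 1) (parityExt σ f) n =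
      ∫ x in Ioo (0 : ℝ) 1, f x *
        ((Complex.exp (-(n * π * x * Complex.I)) +
          σ * Complex.exp (n * π * x * Complex.I)) / 2) := by
  have hfourier : ∀ x : ℝ, (fourier (-n) (x : AddCircle (1 - (-1) : ℝ)) : ℂ) =
      Complex.exp (-(n * π * x * Complex.I)) := fun x => by
    rw [fourier_coe_apply]
    congr 1
    push_cast
    ring
  rw [fourierCoeffOn_eq_integral]
  simp_rw [hfourier, smul_eq_mul, map_parityExt σ f
    (fun x z => Complex.exp (-(n * π * x * Complex.I)) * z) (by simp), mul_comm (Complex.exp _)]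
  rw [integral_indicator_add_indicator_neg (integrableOn_mul_continuous hf (by fun_prop))
    (integrableOn_mul_continuous (hf.const_mul σ) (by fun_prop)), ← integral_smul]
  refine integral_congr_ae (Filter.Eventually.of_forall fun x => ?_)
  simp only [sub_neg_eq_add, one_div, Complex.ofReal_neg, mul_neg, neg_mul, neg_neg, smul_add,
    Complex.real_smul, Complex.ofReal_inv, Complex.ofReal_add, Complex.ofReal_one]
  ring

theorem hasSum_norm_sq_parity {σ : ℂ} (hσ : ‖σ‖ = 1) {f : ℝ → ℂ}
    (hf : MemLp f 2 (volume.restrict (Ioo (0 : ℝ) 1))) :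
    HasSum (fun n : ℤ => ‖∫ x in Ioo (0 : ℝ) 1, f x *
        ((Complex.exp (-(n * π * x * Complex.I)) +
          σ * Complex.exp (n * π * x * Complex.I)) / 2)‖ ^ 2)
      (∫ x in Ioo (0 : ℝ) 1, ‖f x‖ ^ 2) := by
  have hparseval := hasSum_sq_fourierCoeffOn (by norm_num : (-1 : ℝ) < 1)
    ((memLp_parityExt σ hf).restrict _)
  simp_rw [fourierCoeffOn_parityExt σ (hf.integrable one_le_two)] at hparseval
  rw [integral_norm_sq_parityExt hσ hf] at hparseval
  convert hparseval using 1
  rw [smul_eq_mul]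
  ring

/-- The sine coefficient `∫₀¹ f sin(nπx)`. -/
noncomputable def sinCoef (n : ℤ) : L2 →L[ℂ] ℂ :=
  pairing ⟨fun x => Complex.sin (n * π * x), by fun_prop⟩

/-- The cosine coefficient `∫₀¹ f cos(nπx)`. -/
noncomputable def cosCoef (n : ℤ) : L2 →L[ℂ] ℂ :=
  pairing ⟨fun x => Complex.cos (n * π * x), by fun_prop⟩

theorem sinCoef_apply (n : ℤ) (f : L2) :
    sinCoef n f = ∫ x in Ioo (0 : ℝ) 1, f x * Complex.sin (n * π * x) :=
  pairing_apply _ f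

theorem cosCoef_apply (n : ℤ) (f : L2) :
    cosCoef n f = ∫ x in Ioo (0 : ℝ) 1, f x * Complex.cos (n * π * x) :=
  pairing_apply _ f

theorem hasSum_norm_sq_cosCoef (f : L2) : HasSum (fun n : ℤ => ‖cosCoef n f‖ ^ 2) (‖f‖ ^ 2) := by
  rw [← integral_norm_sq]
  convert hasSum_norm_sq_parity (σ := 1) (by simp) (Lp.memLp f) using 5 with n
  rw [cosCoef_apply]
  simp only [Complex.cos, one_mul, neg_mul, add_comm]

theorem hasSum_norm_sq_sinCoef (f : L2) : HasSum (fun n : ℤ => ‖sinCoef n f‖ ^ 2) (‖f‖ ^ 2) := by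
  have hsin : ∀ z, (Complex.exp (-(z * Complex.I)) + -1 * Complex.exp (z * Complex.I)) / 2 =
      -Complex.I * Complex.sin z := fun z => by
    simp only [Complex.sin, neg_mul]
    linear_combination (Complex.exp (-(z * Complex.I)) - Complex.exp (z * Complex.I)) / 2 *
      Complex.I_sq
  have hparseval := hasSum_norm_sq_parity (σ := -1) (by simp) (Lp.memLp f)
  simp_rw [hsin, mul_left_comm _ (-Complex.I), integral_const_mul, ← sinCoef_apply, norm_mul,
    norm_neg, Complex.norm_I, one_mul] at hparseval
  rwa [integral_norm_sq] at hparseval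

theorem hasDerivAt_sin_mode (n : ℤ) (x : ℝ) :
    HasDerivAt (fun y : ℝ => Complex.sin (n * π * y)) (n * π * Complex.cos (n * π * x)) x := by
  simpa [mul_comm] using
    ((Complex.hasDerivAt_sin _).comp (x : ℂ)
      ((hasDerivAt_id (x : ℂ)).const_mul (n * π : ℂ))).comp_ofReal

theorem hasDerivAt_cos_mode (n : ℤ) (x : ℝ) :
    HasDerivAt (fun y : ℝ => Complex.cos (n * π * y)) (-(n * π * Complex.sin (n * π * x))) x := by
  simpa [mul_comm] using
    ((Complex.hasDerivAt_cos _).comp (x : ℂ)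
      ((hasDerivAt_id (x : ℂ)).const_mul (n * π : ℂ))).comp_ofReal

theorem HasWeakDeriv.sinCoef_eq {u g : L2} (h : HasWeakDeriv u g) (n : ℤ) :
    sinCoef n g = -(n * π * cosCoef n u) := by
  have hparts := h.integral_mul_deriv (hasDerivAt_sin_mode n) (by fun_prop) (by simp)
    (by simp [Complex.sin_int_mul_pi])
  simp only [mul_left_comm _ (n * π : ℂ)] at hparts
  rw [integral_const_mul, ← cosCoef_apply, ← sinCoef_apply] at hparts
  rw [hparts, neg_neg]

theorem H10.cosCoef_dx (u : H10) (n : ℤ) : cosCoef n u.dx = n * π * sinCoef n u.fn := by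
  have hparts := u.integral_dx_mul (hasDerivAt_cos_mode n) (by fun_prop)
  simp only [mul_neg, mul_left_comm _ (n * π : ℂ)] at hparts
  rwa [integral_neg, neg_neg, integral_const_mul, ← cosCoef_apply, ← sinCoef_apply] at hparts

theorem sinCoef_zero (f : L2) : sinCoef 0 f = 0 := by
  simp [sinCoef_apply]

theorem one_le_abs_int_mul_pi {n : ℤ} (hn : n ≠ 0) : 1 ≤ |n * π| := by
  rw [abs_mul, abs_of_pos Real.pi_pos]
  have : (1 : ℝ) ≤ |(n : ℝ)| := by exact_mod_cast Int.one_le_abs hn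
  nlinarith [Real.pi_gt_three]

theorem H10.norm_fn_le_norm_dx (u : H10) : ‖u.fn‖ ≤ ‖u.dx‖ := by
  refine le_of_sq_le_sq ?_ (norm_nonneg _)
  refine hasSum_le (fun n => ?_) (hasSum_norm_sq_sinCoef u.fn) (hasSum_norm_sq_cosCoef u.dx)
  rcases eq_or_ne n 0 with rfl | hn
  · simp [sinCoef_zero]
  · rw [u.cosCoef_dx, norm_mul]
    have hn' : 1 ≤ ‖(n * π : ℂ)‖ := by
      simpa using one_le_abs_int_mul_pi hn
    gcongr
    exact le_mul_of_one_le_left (norm_nonneg _) hn'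

theorem H10.norm_sq (u : H10) : ‖u‖ ^ 2 = ‖u.fn‖ ^ 2 + ‖u.dx‖ ^ 2 :=
  WithLp.prod_norm_sq_eq_of_L2 _

end Fourier

section Modes

open scoped Real

/-- The generator of a rescaled Fourier mode: if `(v, p, θ, q)` are the coefficients of
`(∂ₓφ₁, ∂ₜφ₁, φ₂, φ₃)` at frequency `κ`, the system reads `v' = κp`, `p' = κ(θ - v)`,
`θ' = κ(q - p)`, `τq' = -κθ`, and `κ⁻¹ d/dt` acts on `(v, p, θ, √τ q)` by this skew matrix. -/
noncomputable def modeGenerator (τ : ℝ) : EuclideanSpace ℂ (Fin 4) →L[ℝ] EuclideanSpace ℂ (Fin 4) :=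
  (Matrix.toEuclideanCLM (𝕜 := ℂ)
    !![0, 1, 0, 0; -1, 0, 1, 0; 0, -1, 0, (√τ : ℂ)⁻¹; 0, 0, -(√τ : ℂ)⁻¹, 0]).restrictScalars ℝ

theorem modeGenerator_apply (τ : ℝ) (y : EuclideanSpace ℂ (Fin 4)) :
    modeGenerator τ y =
      !₂[y 1, y 2 - y 0, (√τ : ℂ)⁻¹ * y 3 - y 1, -((√τ : ℂ)⁻¹ * y 2)] := by
  ext i
  fin_cases i <;>
    simp [modeGenerator, Matrix.ofLp_toEuclideanCLM, Matrix.mulVec, dotProduct,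
      Fin.sum_univ_four, neg_add_eq_sub]

theorem inner_modeGenerator_self (τ : ℝ) (y : EuclideanSpace ℂ (Fin 4)) :
    inner ℝ y (modeGenerator τ y) = 0 := by
  simp only [modeGenerator_apply, PiLp.inner_apply, Complex.inner, Fin.sum_univ_four,
    Matrix.cons_val, Complex.mul_re, Complex.mul_im, Complex.sub_re, Complex.sub_im,
    Complex.neg_re, Complex.neg_im, Complex.conj_re, Complex.conj_im, ← Complex.ofReal_inv,
    Complex.ofReal_re, Complex.ofReal_im]
  ring

theorem isObservable_modeGenerator {τ : ℝ} (hτ : 0 < τ) :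
    IsObservable (modeGenerator τ) (PiLp.proj (𝕜 := ℝ) 2 (fun _ : Fin 4 => ℂ) 3) := by
  intro y hy
  have hs : (√τ : ℂ) ≠ 0 := by exact_mod_cast (Real.sqrt_pos.2 hτ).ne'
  have h3 : y 3 = 0 := by simpa using hy 0
  have h2 : y 2 = 0 := by simpa [modeGenerator_apply, hs] using hy 1
  have h1 : y 1 = 0 := by simpa [modeGenerator_apply, pow_succ, hs, h3] using hy 2
  have h0 : y 0 = 0 := by simpa [modeGenerator_apply, pow_succ, hs, h3, h2] using hy 3
  ext i
  fin_cases i <;> simp [h0, h1, h2, h3]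

/-- The real linear map sending a state `(u₁, u₂, u₃, u₄)` to its rescaled coefficients in the
`n`-th Fourier mode: cosine for `u₁'` and `u₃`, sine for `u₂` and `√τ u₄`. -/
noncomputable def modeCoeff (τ : ℝ) (n : ℤ) : State →L[ℝ] EuclideanSpace ℂ (Fin 4) :=
  let dx : H10 →L[ℂ] L2 := (WithLp.sndL 2 ℂ L2 L2).comp testPairs.topologicalClosure.subtypeL
  ((EuclideanSpace.equiv (Fin 4) ℂ).symm.toContinuousLinearMap.comp
    (ContinuousLinearMap.pi ![(cosCoef n).comp (dx.comp (.fst ℂ _ _)),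
      (sinCoef n).comp ((ContinuousLinearMap.fst ℂ _ _).comp (.snd ℂ _ _)),
      (cosCoef n).comp ((ContinuousLinearMap.fst ℂ _ _).comp
        ((ContinuousLinearMap.snd ℂ _ _).comp (.snd ℂ _ _))),
      (√τ : ℂ) • (sinCoef n).comp ((ContinuousLinearMap.snd ℂ _ _).comp
        ((ContinuousLinearMap.snd ℂ _ _).comp (.snd ℂ _ _)))])).restrictScalars ℝ

theorem modeCoeff_apply (τ : ℝ) (n : ℤ) (U : State) :
    modeCoeff τ n U = !₂[cosCoef n U.1.dx, sinCoef n U.2.1, cosCoef n U.2.2.1,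
      (√τ : ℂ) * sinCoef n U.2.2.2] := by
  ext i
  fin_cases i <;> rfl

theorem modeCoeff_zero (τ : ℝ) {U : State} (hU : ∫ x in Ioo (0 : ℝ) 1, U.2.2.1 x = 0) :
    modeCoeff τ 0 U = 0 := by
  have hcos : cosCoef 0 U.2.2.1 = 0 := by simpa [cosCoef_apply] using hU
  ext i
  fin_cases i <;> simp [modeCoeff_apply, sinCoef_zero, H10.cosCoef_dx, hcos]

theorem IsGenerator.modeCoeff_eq {τ : ℝ} (hτ : 0 < τ) {U Z : State} (h : IsGenerator τ U Z)
    (n : ℤ) : modeCoeff τ n Z = ((n * π : ℝ) • modeGenerator τ) (modeCoeff τ n U) := by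
  obtain ⟨d₁, w, d₃, q, hd₁, hw, hd₃, hq, hZ₁, hZ₂, hZ₃, hZ₄⟩ := h
  have hs : (√τ : ℂ) ≠ 0 := by exact_mod_cast (Real.sqrt_pos.2 hτ).ne'
  have hsq : (τ : ℂ) = √τ * √τ := by exact_mod_cast (Real.mul_self_sqrt hτ.le).symm
  rw [smul_apply, modeGenerator_apply, modeCoeff_apply, modeCoeff_apply, hZ₁,
    hZ₂, hZ₃, hZ₄, ← hw, ← hq, map_sub, map_sub, map_smul, H10.cosCoef_dx, H10.cosCoef_dx,
    hd₁.sinCoef_eq, hd₃.sinCoef_eq]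
  ext i
  fin_cases i <;>
    simp only [PiLp.smul_apply, Matrix.cons_val, Fin.reduceFinMk, Fin.mk_one, Fin.zero_eta,
      smul_eq_mul, Complex.real_smul, Complex.ofReal_mul, Complex.ofReal_intCast,
      Complex.ofReal_inv, hsq] <;>
    field_simp
  ring

theorem IsSolution.modeCoeff_eq {τ : ℝ} (hτ : 0 < τ) {U : State} {W : ℝ → State}
    (h : IsSolution τ U W) (n : ℤ) {t : ℝ} (ht : 0 ≤ t) :
    modeCoeff τ n (W t) =
      NormedSpace.exp ((n * π * t) • modeGenerator τ) (modeCoeff τ n U) := by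
  have hint : ∀ t, 0 ≤ t → modeCoeff τ n (W t) = modeCoeff τ n U +
      ((n * π : ℝ) • modeGenerator τ) (∫ s in (0 : ℝ)..t, modeCoeff τ n (W s)) := by
    intro t ht
    have hW : IntervalIntegrable W volume 0 t :=
      (h.1.mono Icc_subset_Ici_self).intervalIntegrable_of_Icc ht
    rw [(modeCoeff τ n).intervalIntegral_comp_comm hW, ← (h.2 t ht).modeCoeff_eq hτ, map_sub,
      add_sub_cancel]
  have hflow := eq_exp_smul_apply_of_eq_add_integral
    ((modeCoeff τ n).continuous.comp_continuousOn h.1) hint ht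
  rwa [smul_smul, mul_comm t] at hflow

/-- Twice the energy of a state, which the system conserves. On `H¹₀` it is equivalent to
`State.normSq` by the Poincaré inequality. -/
noncomputable def State.energy (τ : ℝ) (U : State) : ℝ :=
  ‖U.1.dx‖ ^ 2 + ‖U.2.1‖ ^ 2 + ‖U.2.2.1‖ ^ 2 + τ * ‖U.2.2.2‖ ^ 2

theorem hasSum_norm_sq_modeCoeff {τ : ℝ} (hτ : 0 ≤ τ) (U : State) :
    HasSum (fun n => ‖modeCoeff τ n U‖ ^ 2) (U.energy τ) := by
  convert (((hasSum_norm_sq_cosCoef U.1.dx).add (hasSum_norm_sq_sinCoef U.2.1)).add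
    (hasSum_norm_sq_cosCoef U.2.2.1)).add ((hasSum_norm_sq_sinCoef U.2.2.2).mul_left τ) with n
  · simp [modeCoeff_apply, EuclideanSpace.norm_sq_eq, Fin.sum_univ_four, mul_pow, hτ]
  · rfl

theorem State.normSq_le_mul_energy {τ : ℝ} (hτ : 0 < τ) (U : State) :
    U.normSq ≤ (2 + τ⁻¹) * U.energy τ := by
  have hpoincare : ‖U.1.fn‖ ^ 2 ≤ ‖U.1.dx‖ ^ 2 := by
    gcongr
    exact H10.norm_fn_le_norm_dx U.1
  have hrest : 0 ≤ τ⁻¹ * (‖U.1.dx‖ ^ 2 + ‖U.2.1‖ ^ 2 + ‖U.2.2.1‖ ^ 2) + ‖U.2.1‖ ^ 2 +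
      ‖U.2.2.1‖ ^ 2 + 2 * τ * ‖U.2.2.2‖ ^ 2 := by positivity
  have hcancel : τ⁻¹ * (τ * ‖U.2.2.2‖ ^ 2) = ‖U.2.2.2‖ ^ 2 := inv_mul_cancel_left₀ hτ.ne' _
  rw [State.normSq, State.energy, H10.norm_sq]
  linarith

theorem exists_mul_sq_norm_modeCoeff_le {τ T : ℝ} (hτ : 0 < τ) (hT : 0 < T) :
    ∃ c : ℝ, 0 < c ∧ ∀ U : State, ∫ x in Ioo (0 : ℝ) 1, U.2.2.1 x = 0 →
      ∀ W : ℝ → State, IsSolution τ U W → ∀ n : ℤ,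
        c * ‖modeCoeff τ n U‖ ^ 2 ≤ ∫ t in (0 : ℝ)..T, ‖sinCoef n (W t).2.2.2‖ ^ 2 := by
  obtain ⟨c, hc, hobs⟩ := (isObservable_modeGenerator hτ).exists_mul_sq_norm_le_integral_of_skew
    (inner_modeGenerator_self τ) hT
  refine ⟨c / τ, by positivity, fun U hU W hW n => ?_⟩
  rcases eq_or_ne n 0 with rfl | hn
  · simp [modeCoeff_zero τ hU, sinCoef_zero]
  have houtput : ∀ t ∈ uIcc 0 T,
      ‖(NormedSpace.exp ((n * π * t) • modeGenerator τ) (modeCoeff τ n U)) 3‖ ^ 2 =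
        τ * ‖sinCoef n (W t).2.2.2‖ ^ 2 := by
    intro t ht
    rw [uIcc_of_le hT.le] at ht
    rw [← hW.modeCoeff_eq hτ n ht.1]
    simp [modeCoeff_apply, mul_pow, hτ.le]
  rw [div_mul_eq_mul_div, div_le_iff₀ hτ, mul_comm _ τ,
    ← intervalIntegral.integral_const_mul, ← intervalIntegral.integral_congr houtput]
  exact hobs _ (one_le_abs_int_mul_pi hn) _

theorem sum_integral_sq_norm_sinCoef_le {q : ℝ → L2} {T : ℝ} (hT : 0 ≤ T)
    (hq : ContinuousOn q (Icc 0 T)) (s : Finset ℤ) :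
    ∑ n ∈ s, ∫ t in (0 : ℝ)..T, ‖sinCoef n (q t)‖ ^ 2 ≤ ∫ t in (0 : ℝ)..T, ‖q t‖ ^ 2 := by
  have hcoef : ∀ n : ℤ, ContinuousOn (fun t => ‖sinCoef n (q t)‖ ^ 2) (Icc 0 T) := fun n =>
    ((sinCoef n).continuous.comp_continuousOn hq).norm.pow 2
  rw [← intervalIntegral.integral_finsetSum fun n _ => (hcoef n).intervalIntegrable_of_Icc hT]
  refine intervalIntegral.integral_mono_on hT
    ((continuousOn_finsetSum s fun n _ => hcoef n).intervalIntegrable_of_Icc hT)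
    ((hq.norm.pow 2).intervalIntegrable_of_Icc hT) fun t _ => ?_
  exact sum_le_hasSum s (fun _ _ => by positivity) (hasSum_norm_sq_sinCoef (q t))

end Modes

end Cattaneo

theorem proposition5p1_general (τ : ℝ) (hτ : 0 < τ) (T : ℝ) (hT : 0 < T) :
    ∃ C : ℝ, 0 < C ∧
      ∀ U : Cattaneo.State, (∫ x in Set.Ioo (0 : ℝ) 1, U.2.2.1 x) = 0 →
        ∀ W : ℝ → Cattaneo.State, Cattaneo.IsSolution τ U W →
          C * U.normSq ≤ ∫ t in (0 : ℝ)..T, ∫ x in Set.Ioo (0 : ℝ) 1, ‖(W t).2.2.2 x‖ ^ 2 := by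
  obtain ⟨c, hc, hmode⟩ := Cattaneo.exists_mul_sq_norm_modeCoeff_le hτ hT
  refine ⟨c / (2 + τ⁻¹), by positivity, fun U hU W hW => ?_⟩
  have hq : ContinuousOn (fun t => (W t).2.2.2) (Icc 0 T) :=
    (hW.1.mono Icc_subset_Ici_self).snd.snd.snd
  have henergy : c * U.energy τ ≤ ∫ t in (0 : ℝ)..T, ‖(W t).2.2.2‖ ^ 2 :=
    hasSum_le_of_sum_le ((Cattaneo.hasSum_norm_sq_modeCoeff hτ.le U).mul_left c) fun s =>
      (Finset.sum_le_sum fun n _ => hmode U hU W hW n).trans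
        (Cattaneo.sum_integral_sq_norm_sinCoef_le hT.le hq s)
  simp_rw [Cattaneo.integral_norm_sq]
  calc c / (2 + τ⁻¹) * U.normSq
      ≤ c / (2 + τ⁻¹) * ((2 + τ⁻¹) * U.energy τ) := by
        gcongr
        exact Cattaneo.State.normSq_le_mul_energy hτ U
    _ = c * U.energy τ := by field_simp
    _ ≤ ∫ t in (0 : ℝ)..T, ‖(W t).2.2.2‖ ^ 2 := henergy

theorem proposition5p1 (τ : ℝ) (hτ : 0 < τ) (hirr : Irrational (Real.sqrt (τ / (1 + τ))))
    (T : ℝ) (hT : 2 < T) :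
    ∃ C : ℝ, 0 < C ∧
      ∀ U : Cattaneo.State, (∫ x in Set.Ioo (0 : ℝ) 1, U.2.2.1 x) = 0 →
        ∀ W : ℝ → Cattaneo.State, Cattaneo.IsSolution τ U W →
          C * U.normSq ≤ ∫ t in (0 : ℝ)..T, ∫ x in Set.Ioo (0 : ℝ) 1, ‖(W t).2.2.2 x‖ ^ 2 :=
  proposition5p1_general τ hτ T (by linarith)
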